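/- Let $\mathcal G$ be a Hilbert space with a countably infinite orthonormal basis $(e_k)_{k\in\mathbf N}$, $\mathbf N=\{1,2,\dots\}$, let $\mathcal H=L^2(\mathbf R^+,\mathcal G)\cong L^2(\mathbf R^+)\otimes\mathcal G$, and let $\Gamma(\mathcal H)$ be the symmetric Fock space over $\mathcal H$ with vacuum vector $\Omega$, where $\langle u_1\circ\dots\circ u_n,v_1\circ\dots\circ v_m\rangle=\delta_{n,m}\frac1{n!}\sum_{\pi\in S_n}\prod_{i}\langle u_i,v_{\pi(i)}\rangle$. Let $\Gamma_0(\mathcal H)$ be the linear span of $\Omega$ and of all $v_1\circ\dots\circ v_n$ (the finite particle domain), and let $a^*(u)$, $a(u)$ be the boson creation and annihilation operators, $$a^*(u)\,v_1\circ\dots\circ v_n=\sqrt{n+1}\;u\circ v_1\circ\dots\circ v_n,\qquad a(u)\,v_1\circ\dots\circ v_n=\tfrac1{\sqrt n}\sum_{j}\langle u,v_j\rangle\, v_1\circ\dots\breve v_j\dots\circ v_n,\qquad a^*(u)\Omega=u,\quad a(u)\Omega=0 .$$ For $\sigma\subseteq\mathbf N$ and $v=\sum_k v^{(k)}\otimes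 e_k\in\mathcal H$ put $v^{(\sigma)}=\sum_{k\in\sigma}v^{(k)}\otimes e_k$, and let $P^{(\sigma)}$ be the second quantization of the projection $v\mapsto v^{(\sigma)}$. For $k\in\mathbf N$, $\sigma\subseteq\mathbf N$ and $t\ge0$ define on $\Gamma_0(\mathcal H)$ the filtered annihilation, creation, number and time processes $$A_t^{(k,\sigma)}=P^{(\sigma)}a(\chi_{[0,t]}\otimes e_k),\qquad A_t^{(k,\sigma)*}=a^*(\chi_{[0,t]}\otimes e_k)P^{(\sigma)},$$ $$A_t^{(k,\sigma)\circ}\,v_1\circ\dots\circ v_n=\sum_{j=1}^n v_1^{(\sigma)}\circ\dots\circ(\chi_{[0,t]}v_j^{(k)}\otimes e_k)\circ\dots\circ v_n^{(\sigma)},\quad A_t^{(k,\sigma)\circ}\Omega=0,\qquad A_t^{(0,\sigma)}=tP^{(\sigma)},$$ and set $$\Lambda_t^{(k,\sigma)}=A_t^{(k,\sigma)}+A_t^{(k,\sigma)*}+A_t^{(k,\sigma)\circ}+A_t^{(0,\sigma)} .$$ Let $\varphi(T)=\langle\Omega,T\Omega\rangle$ be the vacuum expectation. Then for all $n\ge 0$,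 $k_1,\dots,k_n\in\mathbf N$, $\sigma_1,\dots,\sigma_n\subseteq\mathbf N$ and $t\ge0$, $$\varphi\bigl(\Lambda_t^{(k_1,\sigma_1)}\cdots\Lambda_t^{(k_n,\sigma_n)}\bigr)=\sum_{R\in\mathcal P_n(\vec k,\vec\sigma)}t^{\,b(R)} ,$$ where $b(R)$ is the number of blocks of $R$ and $\mathcal P_n(\vec k,\vec\sigma)$ is the set of all partitions $R$ of $\{1,\dots,n\}$ such that (A1) $k_i=k_j$ whenever $i,j$ lie in the same block of $R$, and (A2) $k_i=k_j\in\sigma_m$ whenever $i<m<j$, where $i,j$ lie in a block of $R$ that does not contain $m$. (These are the mixed moments of the filtered Poisson white noise.) -/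

import Mathlib

open MeasureTheory

namespace FilteredFock

noncomputable section

/-! ### The finite particle space and the symmetric Fock space -/

/-- The finite particle space `Γ₀(E)`, as a vector space: the algebraic direct sum of the algebraic
symmetric tensor powers of `E`, i.e. the symmetric algebra of `E`. -/
abbrev FinFock (E : Type*) [NormedAddCommGroup E] [InnerProductSpace ℂ E] : Type _ :=
  SymmetricAlgebra ℂ E

section Algebraic

variable {E : Type*} [NormedAddCommGroup E] [InnerProductSpace ℂ E]

/-- The vacuum vector `Ω`. -/
def vacuum : FinFock E := 1

/-- The vector `v₁ ∘ ⋯ ∘ vₙ`, with the normalization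
`⟪u₁ ∘ ⋯ ∘ uₙ, v₁ ∘ ⋯ ∘ vₙ⟫ = (n!)⁻¹ ∑_π ∏ᵢ ⟪uᵢ, v_{π i}⟫`; see `inner_symProd`. -/
def symProd {n : ℕ} (v : Fin n → E) : FinFock E :=
  ((√(n.factorial : ℝ) : ℝ) : ℂ)⁻¹ • ∏ i, SymmetricAlgebra.ι ℂ E (v i)

/-- The linear map with
`v₁ ⋯ vₙ ↦ ∑ⱼ (π v₁) ⋯ (T vⱼ) ⋯ (π vₙ)`, where `T` is applied to the `j`-th factor and `π` to
all the other ones; see `replaceOne_prod`. -/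
def replaceOne (π : E →ₗ[ℂ] E) (T : E →ₗ[ℂ] FinFock E) : FinFock E →ₗ[ℂ] FinFock E :=
  (TrivSqZeroExt.sndHom (FinFock E) (FinFock E)).restrictScalars ℂ ∘ₗ
    (SymmetricAlgebra.lift
      ((TrivSqZeroExt.inlAlgHom ℂ (FinFock E) (FinFock E)).toLinearMap ∘ₗ
          SymmetricAlgebra.ι ℂ E ∘ₗ π +
        (TrivSqZeroExt.inrHom (FinFock E) (FinFock E)).restrictScalars ℂ ∘ₗ T)).toLinearMap

/-- Second quantization `Γ(π)`: `v₁ ∘ ⋯ ∘ vₙ ↦ (π v₁) ∘ ⋯ ∘ (π vₙ)`. -/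
def secondQuantization (π : E →ₗ[ℂ] E) : FinFock E →ₗ[ℂ] FinFock E :=
  (SymmetricAlgebra.lift (SymmetricAlgebra.ι ℂ E ∘ₗ π)).toLinearMap

/-- The boson creation operator `a*(u)`:
`v₁ ∘ ⋯ ∘ vₙ ↦ √(n+1) u ∘ v₁ ∘ ⋯ ∘ vₙ`; see `creation_symProd`. -/
def creation (u : E) : FinFock E →ₗ[ℂ] FinFock E :=
  LinearMap.mulLeft ℂ (SymmetricAlgebra.ι ℂ E u)

/-- The boson annihilation operator `a(u)`:
`v₁ ∘ ⋯ ∘ vₙ ↦ (√n)⁻¹ ∑ⱼ ⟪u, vⱼ⟫ v₁ ∘ ⋯ v̌ⱼ ⋯ ∘ vₙ`; see `annihilation_symProd`. -/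
def annihilation (u : E) : FinFock E →ₗ[ℂ] FinFock E :=
  replaceOne LinearMap.id
    (Algebra.linearMap ℂ (FinFock E) ∘ₗ (innerSL ℂ u).toLinearMap)

theorem replaceOne_fst (π : E →ₗ[ℂ] E) (T : E →ₗ[ℂ] FinFock E) (x : FinFock E) :
    (SymmetricAlgebra.lift
      ((TrivSqZeroExt.inlAlgHom ℂ (FinFock E) (FinFock E)).toLinearMap ∘ₗ
          SymmetricAlgebra.ι ℂ E ∘ₗ π +
        (TrivSqZeroExt.inrHom (FinFock E) (FinFock E)).restrictScalars ℂ ∘ₗ T) x).fst =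
      secondQuantization π x := by
  have : (TrivSqZeroExt.fstHom ℂ (FinFock E) (FinFock E)).comp (SymmetricAlgebra.lift
      ((TrivSqZeroExt.inlAlgHom ℂ (FinFock E) (FinFock E)).toLinearMap ∘ₗ
          SymmetricAlgebra.ι ℂ E ∘ₗ π +
        (TrivSqZeroExt.inrHom (FinFock E) (FinFock E)).restrictScalars ℂ ∘ₗ T)) =
      SymmetricAlgebra.lift (SymmetricAlgebra.ι ℂ E ∘ₗ π) := by
    apply SymmetricAlgebra.algHom_ext
    ext v
    simp
  exact congrArg (fun F : FinFock E →ₐ[ℂ] FinFock E => F x) this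

theorem replaceOne_ι (π : E →ₗ[ℂ] E) (T : E →ₗ[ℂ] FinFock E) (v : E) :
    replaceOne π T (SymmetricAlgebra.ι ℂ E v) = T v := by
  simp [replaceOne]

theorem replaceOne_one (π : E →ₗ[ℂ] E) (T : E →ₗ[ℂ] FinFock E) :
    replaceOne π T 1 = 0 := by
  simp [replaceOne]

theorem replaceOne_mul (π : E →ₗ[ℂ] E) (T : E →ₗ[ℂ] FinFock E) (x y : FinFock E) :
    replaceOne π T (x * y) =
      replaceOne π T x * secondQuantization π y + secondQuantization π x * replaceOne π T y := by
  rw [← replaceOne_fst π T x, ← replaceOne_fst π T y]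
  simp only [replaceOne, LinearMap.comp_apply, AlgHom.toLinearMap_apply, map_mul,
    LinearMap.restrictScalars_apply, TrivSqZeroExt.sndHom_apply, TrivSqZeroExt.snd_mul,
    smul_eq_mul, MulOpposite.smul_eq_mul_unop, MulOpposite.unop_op]
  exact add_comm _ _

@[simp] theorem secondQuantization_id :
    secondQuantization (LinearMap.id : E →ₗ[ℂ] E) = LinearMap.id := by
  ext x
  simp [secondQuantization]

theorem secondQuantization_prod {ι : Type*} (π : E →ₗ[ℂ] E) (s : Finset ι) (v : ι → E) :
    secondQuantization π (∏ i ∈ s, SymmetricAlgebra.ι ℂ E (v i)) =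
      ∏ i ∈ s, SymmetricAlgebra.ι ℂ E (π (v i)) := by
  simp [secondQuantization, map_prod]

theorem replaceOne_prod {ι : Type*} [DecidableEq ι] (π : E →ₗ[ℂ] E) (T : E →ₗ[ℂ] FinFock E)
    (s : Finset ι) (v : ι → E) :
    replaceOne π T (∏ i ∈ s, SymmetricAlgebra.ι ℂ E (v i)) =
      ∑ j ∈ s, T (v j) * ∏ i ∈ s.erase j, SymmetricAlgebra.ι ℂ E (π (v i)) := by
  induction s using Finset.induction_on with
  | empty => simp [replaceOne_one]
  | insert a s ha ih =>
    rw [Finset.prod_insert ha, replaceOne_mul, ih, replaceOne_ι, secondQuantization_prod,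
      Finset.sum_insert ha, Finset.erase_insert ha, Finset.mul_sum]
    congr 1
    refine Finset.sum_congr rfl fun j hj => ?_
    have hja : j ≠ a := fun h => ha (h ▸ hj)
    rw [Finset.erase_insert_of_ne hja.symm, Finset.prod_insert (by simp [ha])]
    simp [secondQuantization]
    ring

/-! ### The inner product of the finite particle space -/

theorem annihilation_one (u : E) : annihilation u 1 = 0 := replaceOne_one _ _

theorem annihilation_algebraMap (u : E) (c : ℂ) :
    annihilation u (algebraMap ℂ (FinFock E) c) = 0 := by
  rw [Algebra.algebraMap_eq_smul_one, map_smul, annihilation_one, smul_zero]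

theorem annihilation_ι (u v : E) :
    annihilation u (SymmetricAlgebra.ι ℂ E v) = algebraMap ℂ (FinFock E) (inner ℂ u v) := by
  simp [annihilation, replaceOne_ι]

theorem annihilation_mul (u : E) (x y : FinFock E) :
    annihilation u (x * y) = annihilation u x * y + x * annihilation u y := by
  simp [annihilation, replaceOne_mul]

theorem annihilation_add (u v : E) (x : FinFock E) :
    annihilation (u + v) x = annihilation u x + annihilation v x := by
  induction x using SymmetricAlgebra.induction with
  | algebraMap r => simp [annihilation_algebraMap]
  | ι x => simp only [annihilation_ι, inner_add_left, map_add]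
  | mul a b ha hb => simp only [annihilation_mul, ha, hb]; ring
  | add a b ha hb => simp only [map_add, ha, hb]; ring

theorem annihilation_smul (c : ℂ) (u : E) (x : FinFock E) :
    annihilation (c • u) x = (starRingEnd ℂ c) • annihilation u x := by
  induction x using SymmetricAlgebra.induction with
  | algebraMap r => simp [annihilation_algebraMap]
  | ι x => simp only [annihilation_ι, inner_smul_left, map_mul, Algebra.smul_def]
  | mul a b ha hb => simp only [annihilation_mul, ha, hb, Algebra.smul_def]; ring
  | add a b ha hb => simp only [map_add, ha, hb, smul_add]

theorem annihilation_comm (u v : E) (x : FinFock E) :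
    annihilation u (annihilation v x) = annihilation v (annihilation u x) := by
  induction x using SymmetricAlgebra.induction with
  | algebraMap r => simp [annihilation_algebraMap]
  | ι x => simp [annihilation_ι, annihilation_algebraMap]
  | mul a b ha hb => simp only [annihilation_mul, ha, hb, map_add]; ring
  | add a b ha hb => simp only [map_add, ha, hb]

/-- A linear map into an algebra with commuting values extends to an algebra homomorphism on the
symmetric algebra. -/
theorem exists_linear_lift {A : Type*} [Ring A] [Algebra ℂ A] (f : E → A)
    (hadd : ∀ u v, f (u + v) = f u + f v)
    (hsmul : ∀ (c : ℂ) u, f (c • u) = algebraMap ℂ A c * f u)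
    (hcomm : ∀ u v, f u * f v = f v * f u) :
    ∃ F : FinFock E →ₐ[ℂ] A, ∀ u, F (SymmetricAlgebra.ι ℂ E u) = f u := by
  have hS : IsMulCommutative (Algebra.adjoin ℂ (Set.range f)) :=
    Algebra.isMulCommutative_adjoin ℂ (by
      rintro _ ⟨u, rfl⟩ _ ⟨v, rfl⟩
      exact hcomm u v)
  let g : E →ₗ[ℂ] Algebra.adjoin ℂ (Set.range f) :=
    { toFun := fun u => ⟨f u, Algebra.subset_adjoin ⟨u, rfl⟩⟩
      map_add' := fun u v => Subtype.ext (hadd u v)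
      map_smul' := fun c u => Subtype.ext (by simp [hsmul, Algebra.smul_def]) }
  open scoped IsMulCommutative in
  exact ⟨(Algebra.adjoin ℂ (Set.range f)).val.comp (SymmetricAlgebra.lift g), fun u => by
    simp [g]⟩

/-- An antilinear map into an algebra with commuting values extends to an antilinear ring
homomorphism on the symmetric algebra. -/
theorem exists_antilinear_lift {A : Type*} [Ring A] [Algebra ℂ A] (f : E → A)
    (hadd : ∀ u v, f (u + v) = f u + f v)
    (hsmul : ∀ (c : ℂ) u, f (c • u) = (starRingEnd ℂ c) • f u)
    (hcomm : ∀ u v, f u * f v = f v * f u) :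
    ∃ F : FinFock E →+* A, (∀ u, F (SymmetricAlgebra.ι ℂ E u) = f u) ∧
      ∀ c : ℂ, F (algebraMap ℂ _ c) = algebraMap ℂ A (starRingEnd ℂ c) := by
  have hsmul' : ∀ (c : ℂ) u, f (c • u) = algebraMap ℂ A (starRingEnd ℂ c) * f u := fun c u => by
    rw [hsmul, Algebra.smul_def]
  let al : Algebra ℂ A := ((algebraMap ℂ A).comp (starRingEnd ℂ)).toAlgebra'
    (fun c x => Algebra.commutes _ x)
  obtain ⟨F, hF⟩ := @exists_linear_lift E _ _ A _ al f hadd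
    hsmul' hcomm
  exact ⟨@AlgHom.toRingHom ℂ (FinFock E) A _ _ _ _ al F, hF,
    fun c => @AlgHom.commutes ℂ (FinFock E) A _ _ _ _ al F c⟩

/-- The antilinear ring homomorphism with `u₁ ⋯ uₙ ↦ a(u₁) ⋯ a(uₙ)`. -/
def annihilationHom (E : Type*) [NormedAddCommGroup E] [InnerProductSpace ℂ E] :
    FinFock E →+* Module.End ℂ (FinFock E) :=
  (exists_antilinear_lift (fun u : E => (annihilation u : Module.End ℂ (FinFock E)))
    (fun u v => LinearMap.ext (annihilation_add u v))
    (fun c u => LinearMap.ext (annihilation_smul c u))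
    (fun u v => LinearMap.ext (annihilation_comm u v))).choose

theorem annihilationHom_ι (u : E) :
    annihilationHom E (SymmetricAlgebra.ι ℂ E u) = annihilation u :=
  (exists_antilinear_lift (fun u : E => (annihilation u : Module.End ℂ (FinFock E)))
    (fun u v => LinearMap.ext (annihilation_add u v))
    (fun c u => LinearMap.ext (annihilation_smul c u))
    (fun u v => LinearMap.ext (annihilation_comm u v))).choose_spec.1 u

theorem annihilationHom_algebraMap (c : ℂ) :
    annihilationHom E (algebraMap ℂ _ c) =
      algebraMap ℂ (Module.End ℂ (FinFock E)) (starRingEnd ℂ c) :=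
  (exists_antilinear_lift (fun u : E => (annihilation u : Module.End ℂ (FinFock E)))
    (fun u v => LinearMap.ext (annihilation_add u v))
    (fun c u => LinearMap.ext (annihilation_smul c u))
    (fun u v => LinearMap.ext (annihilation_comm u v))).choose_spec.2 c

/-- The inner product of the finite particle space: `⟪u₁ ⋯ uₙ, y⟫` is the vacuum coefficient of
`a(u₁) ⋯ a(uₙ) y`, so that `⟪u₁ ⋯ uₙ, v₁ ⋯ vₘ⟫ = δₙₘ ∑_π ∏ᵢ ⟪uᵢ, v_{π i}⟫`. -/
def fockInner (x y : FinFock E) : ℂ :=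
  SymmetricAlgebra.algebraMapInv (annihilationHom E x y)

theorem fockInner_add_left (x y z : FinFock E) :
    fockInner (x + y) z = fockInner x z + fockInner y z := by
  simp [fockInner]

theorem fockInner_add_right (x y z : FinFock E) :
    fockInner x (y + z) = fockInner x y + fockInner x z := by
  simp [fockInner]

theorem fockInner_smul_right (c : ℂ) (x y : FinFock E) :
    fockInner x (c • y) = c * fockInner x y := by
  simp [fockInner]

theorem fockInner_smul_left (c : ℂ) (x y : FinFock E) :
    fockInner (c • x) y = (starRingEnd ℂ c) * fockInner x y := by
  simp [fockInner, Algebra.smul_def, annihilationHom_algebraMap]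

theorem fockInner_one_left (y : FinFock E) :
    fockInner 1 y = SymmetricAlgebra.algebraMapInv y := by
  simp [fockInner]

theorem fockInner_ι_mul (u : E) (x y : FinFock E) :
    fockInner (SymmetricAlgebra.ι ℂ E u * x) y = fockInner x (annihilation u y) := by
  rw [mul_comm, fockInner, map_mul, annihilationHom_ι]
  rfl

theorem annihilation_aeval {d : ℕ} (b : Fin d → E) (hb : Orthonormal ℂ b) (i : Fin d)
    (p : MvPolynomial (Fin d) ℂ) :
    annihilation (b i) (MvPolynomial.aeval (fun j => SymmetricAlgebra.ι ℂ E (b j)) p) =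
      MvPolynomial.aeval (fun j => SymmetricAlgebra.ι ℂ E (b j)) (MvPolynomial.pderiv i p) := by
  induction p using MvPolynomial.induction_on with
  | C c => simp [annihilation_algebraMap]
  | add p q hp hq => simp [hp, hq]
  | mul_X p j hp =>
    rw [map_mul, annihilation_mul, hp, MvPolynomial.aeval_X, annihilation_ι,
      MvPolynomial.pderiv_mul, MvPolynomial.pderiv_X, map_add, map_mul, map_mul,
      MvPolynomial.aeval_X]
    by_cases h : i = j
    · subst h
      simp [hb.1 i]
    · have : inner ℂ (b i) (b j) = (0 : ℂ) := hb.2 h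
      simp [this, Ne.symm h]

theorem fockInner_monomial_aeval {d : ℕ} (b : Fin d → E) (hb : Orthonormal ℂ b)
    (α : Fin d →₀ ℕ) (p : MvPolynomial (Fin d) ℂ) :
    fockInner (MvPolynomial.aeval (fun j => SymmetricAlgebra.ι ℂ E (b j))
        (MvPolynomial.monomial α (1 : ℂ)))
      (MvPolynomial.aeval (fun j => SymmetricAlgebra.ι ℂ E (b j)) p) =
      ((∏ i, (α i).factorial : ℕ) : ℂ) * p.coeff α := by
  obtain ⟨N, hN⟩ : ∃ N, α.degree = N := ⟨_, rfl⟩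
  induction N generalizing α p with
  | zero =>
    obtain rfl := (Finsupp.degree_eq_zero_iff α).1 hN
    rw [MvPolynomial.monomial_zero', map_one, map_one, fockInner_one_left]
    have : (SymmetricAlgebra.algebraMapInv (R := ℂ) (M := E)).comp
        (MvPolynomial.aeval (fun j => SymmetricAlgebra.ι ℂ E (b j))) =
        MvPolynomial.aeval (fun _ => (0 : ℂ)) := by
      ext j
      simp [SymmetricAlgebra.algebraMapInv_ι]
    have h2 := congrArg (fun F : MvPolynomial (Fin d) ℂ →ₐ[ℂ] ℂ => F p) this
    simp only [AlgHom.comp_apply] at h2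
    rw [h2]
    simp [MvPolynomial.aeval_zero', MvPolynomial.constantCoeff_eq]
  | succ N ih =>
    obtain ⟨i, hi⟩ : ∃ i, α i ≠ 0 := by
      by_contra! h
      have : α = 0 := Finsupp.ext h
      simp [this] at hN
    have hle : Finsupp.single i 1 ≤ α := by
      rw [Finsupp.single_le_iff]
      omega
    obtain ⟨β, rfl⟩ := exists_add_of_le hle
    have hβ : β.degree = N := by
      rw [map_add, Finsupp.degree_single] at hN
      omega
    have h1 : MvPolynomial.monomial (Finsupp.single i 1 + β) (1 : ℂ) =
        MvPolynomial.X i * MvPolynomial.monomial β 1 := by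
      rw [MvPolynomial.X, MvPolynomial.monomial_mul, one_mul]
    rw [h1, map_mul, MvPolynomial.aeval_X, fockInner_ι_mul, annihilation_aeval b hb, ih _ _ hβ,
      MvPolynomial.coeff_pderiv, ← Finset.mul_prod_erase _ _ (Finset.mem_univ i),
      ← Finset.mul_prod_erase _
        (fun j => ((Finsupp.single i 1 + β : Fin d →₀ ℕ) : Fin d → ℕ) j |>.factorial)
        (Finset.mem_univ i)]
    have h3 : ∏ j ∈ Finset.univ.erase i, (((Finsupp.single i 1 + β : Fin d →₀ ℕ)) j).factorial =
        ∏ j ∈ Finset.univ.erase i, (β j).factorial := by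
      refine Finset.prod_congr rfl fun j hj => ?_
      simp [Finsupp.single_eq_of_ne (Finset.ne_of_mem_erase hj)]
    rw [h3]
    simp only [Finsupp.add_apply, Finsupp.single_eq_same, add_comm 1, Nat.factorial_succ]
    rw [add_comm β]
    push_cast
    ring

theorem fockInner_aeval_aeval {d : ℕ} (b : Fin d → E) (hb : Orthonormal ℂ b)
    (p q : MvPolynomial (Fin d) ℂ) :
    fockInner (MvPolynomial.aeval (fun j => SymmetricAlgebra.ι ℂ E (b j)) p)
      (MvPolynomial.aeval (fun j => SymmetricAlgebra.ι ℂ E (b j)) q) =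
      ∑ α ∈ p.support ∪ q.support,
        ((∏ i, (α i).factorial : ℕ) : ℂ) * (starRingEnd ℂ (p.coeff α) * q.coeff α) := by
  let L : MvPolynomial (Fin d) ℂ → ℂ := fun p =>
    fockInner (MvPolynomial.aeval (fun j => SymmetricAlgebra.ι ℂ E (b j)) p)
      (MvPolynomial.aeval (fun j => SymmetricAlgebra.ι ℂ E (b j)) q)
  have hL0 : L 0 = 0 := by simp [L, fockInner]
  have hLadd : ∀ p p', L (p + p') = L p + L p' := fun p p' => by
    simp [L, fockInner_add_left]
  have hLsum : ∀ (s : Finset (Fin d →₀ ℕ)) (g : (Fin d →₀ ℕ) → MvPolynomial (Fin d) ℂ),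
      L (∑ α ∈ s, g α) = ∑ α ∈ s, L (g α) := fun s g =>
    map_sum (⟨⟨L, hL0⟩, hLadd⟩ : MvPolynomial (Fin d) ℂ →+ ℂ) g s
  have hp : p = ∑ α ∈ p.support ∪ q.support, MvPolynomial.monomial α (p.coeff α) := by
    conv_lhs => rw [p.as_sum]
    refine Finset.sum_subset Finset.subset_union_left fun α _ h => ?_
    rw [MvPolynomial.notMem_support_iff.1 h, map_zero]
  change L p = _
  conv_lhs => rw [hp]
  rw [hLsum]
  refine Finset.sum_congr rfl fun α _ => ?_
  have h1 : MvPolynomial.monomial α (p.coeff α) =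
      p.coeff α • MvPolynomial.monomial α (1 : ℂ) := by
    rw [MvPolynomial.smul_monomial, smul_eq_mul, mul_one]
  simp only [L]
  rw [h1, map_smul, fockInner_smul_left, fockInner_monomial_aeval b hb]
  ring

theorem exists_submodule_mem_adjoin (x : FinFock E) :
    ∃ V : Submodule ℂ E, FiniteDimensional ℂ V ∧
      x ∈ Algebra.adjoin ℂ (SymmetricAlgebra.ι ℂ E '' (V : Set E)) := by
  have mono : ∀ V W : Submodule ℂ E, V ≤ W →
      Algebra.adjoin ℂ (SymmetricAlgebra.ι ℂ E '' (V : Set E)) ≤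
        Algebra.adjoin ℂ (SymmetricAlgebra.ι ℂ E '' (W : Set E)) := fun V W h =>
    Algebra.adjoin_mono (Set.image_mono h)
  induction x using SymmetricAlgebra.induction with
  | algebraMap r => exact ⟨⊥, inferInstance, Subalgebra.algebraMap_mem _ _⟩
  | ι x =>
    exact ⟨Submodule.span ℂ {x}, inferInstance,
      Algebra.subset_adjoin ⟨x, Submodule.mem_span_singleton_self x, rfl⟩⟩
  | mul x y hx hy =>
    obtain ⟨V, hV, hx⟩ := hx
    obtain ⟨W, hW, hy⟩ := hy
    exact ⟨V ⊔ W, inferInstance,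
      mul_mem (mono _ _ le_sup_left hx) (mono _ _ le_sup_right hy)⟩
  | add x y hx hy =>
    obtain ⟨V, hV, hx⟩ := hx
    obtain ⟨W, hW, hy⟩ := hy
    exact ⟨V ⊔ W, inferInstance,
      add_mem (mono _ _ le_sup_left hx) (mono _ _ le_sup_right hy)⟩

theorem exists_orthonormal_aeval (x y : FinFock E) :
    ∃ (d : ℕ) (b : Fin d → E) (p q : MvPolynomial (Fin d) ℂ), Orthonormal ℂ b ∧
      x = MvPolynomial.aeval (fun j => SymmetricAlgebra.ι ℂ E (b j)) p ∧
      y = MvPolynomial.aeval (fun j => SymmetricAlgebra.ι ℂ E (b j)) q := by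
  obtain ⟨V, hV, hx⟩ := exists_submodule_mem_adjoin x
  obtain ⟨W, hW, hy⟩ := exists_submodule_mem_adjoin y
  let b := stdOrthonormalBasis ℂ (V ⊔ W : Submodule ℂ E)
  have key : ∀ U : Submodule ℂ E, U ≤ V ⊔ W →
      Algebra.adjoin ℂ (SymmetricAlgebra.ι ℂ E '' (U : Set E)) ≤
        (MvPolynomial.aeval (R := ℂ)
          (fun j => SymmetricAlgebra.ι ℂ E (b j : E))).range := by
    intro U hU
    refine Algebra.adjoin_le ?_
    rintro _ ⟨u, hu, rfl⟩
    have h : u = ∑ j, b.repr ⟨u, hU hu⟩ j • (b j : E) := by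
      have := congrArg Subtype.val (b.sum_repr ⟨u, hU hu⟩)
      simpa using this.symm
    rw [h, map_sum]
    refine sum_mem fun j _ => ?_
    rw [map_smul]
    exact Subalgebra.smul_mem _ (AlgHom.mem_range _ |>.2 ⟨MvPolynomial.X j, by simp⟩) _
  obtain ⟨p, hp⟩ := key V le_sup_left hx
  obtain ⟨q, hq⟩ := key W le_sup_right hy
  refine ⟨_, fun j => (b j : E), p, q, ?_, hp.symm, hq.symm⟩
  exact b.orthonormal.comp_linearIsometry (V ⊔ W : Submodule ℂ E).subtypeₗᵢ

/-- The inner product on the finite particle space is positive definite. -/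
@[reducible] def fockCore (E : Type*) [NormedAddCommGroup E] [InnerProductSpace ℂ E] :
    InnerProductSpace.Core ℂ (FinFock E) where
  inner := fockInner
  conj_inner_symm x y := by
    obtain ⟨d, b, p, q, hb, rfl, rfl⟩ := exists_orthonormal_aeval x y
    rw [fockInner_aeval_aeval b hb, fockInner_aeval_aeval b hb, map_sum, Finset.union_comm]
    refine Finset.sum_congr rfl fun α _ => ?_
    simp only [map_mul, map_natCast, Complex.conj_conj]
    ring
  re_inner_nonneg x := by
    obtain ⟨d, b, p, -, hb, rfl, -⟩ := exists_orthonormal_aeval x x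
    rw [fockInner_aeval_aeval b hb, map_sum]
    refine Finset.sum_nonneg fun α _ => ?_
    rw [← Complex.normSq_eq_conj_mul_self, ← Complex.ofReal_natCast, ← Complex.ofReal_mul]
    exact mul_nonneg (Nat.cast_nonneg _) (Complex.normSq_nonneg _)
  add_left := fockInner_add_left
  smul_left x y r := fockInner_smul_left r x y
  definite x hx := by
    obtain ⟨d, b, p, -, hb, rfl, -⟩ := exists_orthonormal_aeval x x
    change fockInner _ _ = 0 at hx
    rw [fockInner_aeval_aeval b hb] at hx
    have h1 : ∑ α ∈ p.support ∪ p.support,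
        ((∏ i, (α i).factorial : ℕ) : ℝ) * Complex.normSq (p.coeff α) = 0 := by
      rw [← Complex.ofReal_inj, Complex.ofReal_zero, ← hx, Complex.ofReal_sum]
      refine Finset.sum_congr rfl fun α _ => ?_
      rw [← Complex.normSq_eq_conj_mul_self, Complex.ofReal_mul, Complex.ofReal_natCast]
    have hp : p = 0 := by
      ext α
      by_contra hα
      have h2 := (Finset.sum_eq_zero_iff_of_nonneg (fun α _ =>
        mul_nonneg (Nat.cast_nonneg _) (Complex.normSq_nonneg _))).1 h1 α
          (Finset.mem_union_left _ (MvPolynomial.mem_support_iff.2 hα))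
      rcases mul_eq_zero.1 h2 with h | h
      · exact (Finset.prod_ne_zero_iff.2 fun i _ => Nat.factorial_ne_zero _)
          (Nat.cast_eq_zero.1 h)
      · exact hα (Complex.normSq_eq_zero.1 h)
    rw [hp, map_zero]

instance (E : Type*) [NormedAddCommGroup E] [InnerProductSpace ℂ E] :
    NormedAddCommGroup (FinFock E) :=
  (fockCore E).toNormedAddCommGroup

instance (E : Type*) [NormedAddCommGroup E] [InnerProductSpace ℂ E] :
    InnerProductSpace ℂ (FinFock E) :=
  InnerProductSpace.ofCore (fockCore E).toCore

theorem inner_eq_fockInner (x y : FinFock E) : inner ℂ x y = fockInner x y := rfl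

theorem inner_prod {n : ℕ} (u v : Fin n → E) :
    inner ℂ (∏ i, SymmetricAlgebra.ι ℂ E (u i) : FinFock E)
        (∏ i, SymmetricAlgebra.ι ℂ E (v i) : FinFock E) =
      ∑ π : Equiv.Perm (Fin n), ∏ i, inner ℂ (u i) (v (π i)) := by
  rw [inner_eq_fockInner]
  induction n with
  | zero => simp [fockInner_one_left]
  | succ n ih =>
    rw [Fin.prod_univ_succ, fockInner_ι_mul, annihilation, replaceOne_prod]
    have h1 : ∀ p : Fin (n + 1),
        (Algebra.linearMap ℂ (FinFock E) ∘ₗ (innerSL ℂ (u 0)).toLinearMap) (v p) *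
          ∏ i ∈ Finset.univ.erase p, SymmetricAlgebra.ι ℂ E ((LinearMap.id : E →ₗ[ℂ] E) (v i)) =
        (inner ℂ (u 0) (v p) : ℂ) •
          ∏ i : Fin n, SymmetricAlgebra.ι ℂ E (v (Equiv.swap 0 p i.succ)) := by
      intro p
      have h2 : ∏ i ∈ Finset.univ.erase p, SymmetricAlgebra.ι ℂ E (v i) =
          ∏ i : Fin n, SymmetricAlgebra.ι ℂ E (v (Equiv.swap 0 p i.succ)) := by
        have h3 : (Finset.univ.erase p : Finset (Fin (n + 1))) =
            Finset.univ.map ((Fin.succEmb n).trans (Equiv.swap 0 p).toEmbedding) := by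
          ext j
          simp only [Finset.mem_erase, Finset.mem_univ, and_true, Finset.mem_map,
            Function.Embedding.trans_apply, true_and, Fin.coe_succEmb, Equiv.coe_toEmbedding]
          constructor
          · intro hj
            have : Equiv.swap 0 p j ≠ 0 := by
              intro h0
              apply hj
              have := congrArg (Equiv.swap 0 p) h0
              rwa [Equiv.swap_apply_self, Equiv.swap_apply_left] at this
            obtain ⟨i, hi⟩ := Fin.exists_succ_eq.2 this
            exact ⟨i, by rw [hi, Equiv.swap_apply_self]⟩
          · rintro ⟨i, rfl⟩ h0
            have := congrArg (Equiv.swap 0 p) h0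
            rw [Equiv.swap_apply_self, Equiv.swap_apply_right] at this
            exact Fin.succ_ne_zero i this
        rw [h3, Finset.prod_map]
        rfl
      simp only [LinearMap.id_apply]
      rw [h2, Algebra.smul_def]
      rfl
    rw [Finset.sum_congr rfl fun p _ => h1 p, ← Equiv.sum_comp Equiv.Perm.decomposeFin.symm,
      Fintype.sum_prod_type]
    have h4 : ∀ (s : Finset (Fin (n + 1))) (x : FinFock E) (g : Fin (n + 1) → FinFock E),
        fockInner x (∑ p ∈ s, g p) = ∑ p ∈ s, fockInner x (g p) := fun s x g => by
      simp [fockInner]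
    rw [h4]
    refine Finset.sum_congr rfl fun p _ => ?_
    rw [fockInner_smul_right, ih, Finset.mul_sum]
    refine Finset.sum_congr rfl fun e _ => ?_
    rw [Fin.prod_univ_succ]
    simp

theorem inner_symProd {n : ℕ} (u v : Fin n → E) :
    inner ℂ (symProd u) (symProd v) =
      (n.factorial : ℂ)⁻¹ * ∑ π : Equiv.Perm (Fin n), ∏ i, inner ℂ (u i) (v (π i)) := by
  have h : (((√(n.factorial : ℝ) : ℝ) : ℂ))⁻¹ * (((√(n.factorial : ℝ) : ℝ) : ℂ))⁻¹ =
      (n.factorial : ℂ)⁻¹ := by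
    rw [← mul_inv, ← Complex.ofReal_mul, Real.mul_self_sqrt (Nat.cast_nonneg _),
      Complex.ofReal_natCast]
  rw [symProd, symProd, inner_smul_left, inner_smul_right, inner_prod, ← mul_assoc, ← h, map_inv₀,
    Complex.conj_ofReal]

theorem annihilation_prod (u : E) {n : ℕ} (v : Fin (n + 1) → E) :
    annihilation u (∏ i, SymmetricAlgebra.ι ℂ E (v i)) =
      ∑ j, (inner ℂ u (v j) : ℂ) • ∏ i : Fin n, SymmetricAlgebra.ι ℂ E (v (j.succAbove i)) := by
  rw [annihilation, replaceOne_prod]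
  refine Finset.sum_congr rfl fun j _ => ?_
  have h : (Finset.univ.erase j : Finset (Fin (n + 1))) = Finset.univ.map j.succAboveEmb := by
    rw [Fin.univ_succAbove n j, Finset.erase_cons]
  rw [h, Finset.prod_map, Algebra.smul_def]
  rfl

theorem inner_symProd_of_ne {n m : ℕ} (h : n ≠ m) (u : Fin n → E) (v : Fin m → E) :
    inner ℂ (symProd u) (symProd v) = 0 := by
  have key : ∀ (n m : ℕ), n ≠ m → ∀ (u : Fin n → E) (v : Fin m → E),
      fockInner (∏ i, SymmetricAlgebra.ι ℂ E (u i)) (∏ i, SymmetricAlgebra.ι ℂ E (v i)) = 0 := by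
    clear h u v n m
    intro n
    induction n with
    | zero =>
      intro m hm u v
      obtain ⟨m, rfl⟩ := Nat.exists_eq_succ_of_ne_zero hm.symm
      rw [Fin.prod_univ_zero, fockInner_one_left, Fin.prod_univ_succ, map_mul,
        SymmetricAlgebra.algebraMapInv_ι, zero_mul]
    | succ n ih =>
      intro m hm u v
      rw [Fin.prod_univ_succ, fockInner_ι_mul]
      cases m with
      | zero => simp [annihilation_one, fockInner]
      | succ m =>
        rw [annihilation_prod]
        have h4 : ∀ (s : Finset (Fin (m + 1))) (x : FinFock E) (g : Fin (m + 1) → FinFock E),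
            fockInner x (∑ p ∈ s, g p) = ∑ p ∈ s, fockInner x (g p) := fun s x g => by
          simp [fockInner]
        rw [h4]
        refine Finset.sum_eq_zero fun p _ => ?_
        rw [fockInner_smul_right, ih m (by omega), mul_zero]
  rw [symProd, symProd, inner_smul_left, inner_smul_right, inner_eq_fockInner, key n m h]
  simp

theorem secondQuantization_symProd (π : E →ₗ[ℂ] E) {n : ℕ} (v : Fin n → E) :
    secondQuantization π (symProd v) = symProd (fun i => π (v i)) := by
  rw [symProd, map_smul, secondQuantization_prod, symProd]

theorem inv_sqrt_factorial_succ (n : ℕ) : ((√((n + 1).factorial : ℝ) : ℝ) : ℂ)⁻¹ =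
    ((√(n + 1 : ℝ) : ℝ) : ℂ)⁻¹ * ((√(n.factorial : ℝ) : ℝ) : ℂ)⁻¹ := by
  rw [Nat.factorial_succ, Nat.cast_mul, Real.sqrt_mul (Nat.cast_nonneg _), Complex.ofReal_mul,
    mul_inv]
  push_cast
  rfl

theorem creation_symProd (u : E) {n : ℕ} (v : Fin n → E) :
    creation u (symProd v) = ((√(n + 1 : ℝ) : ℝ) : ℂ) • symProd (Fin.cons u v : Fin (n + 1) → E) := by
  have h0 : ((√(n + 1 : ℝ) : ℝ) : ℂ) ≠ 0 :=
    Complex.ofReal_ne_zero.2 (Real.sqrt_ne_zero'.2 (by positivity))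
  rw [symProd, symProd, map_smul, inv_sqrt_factorial_succ, smul_smul, mul_inv_cancel_left₀ h0,
    Fin.prod_univ_succ]
  simp [creation]

theorem annihilation_symProd (u : E) {n : ℕ} (v : Fin (n + 1) → E) :
    annihilation u (symProd v) = ((√(n + 1 : ℝ) : ℝ) : ℂ)⁻¹ •
      ∑ j, (inner ℂ u (v j) : ℂ) • symProd (fun i => v (j.succAbove i)) := by
  rw [symProd, map_smul, annihilation_prod, inv_sqrt_factorial_succ, mul_smul]
  congr 1
  rw [Finset.smul_sum]
  refine Finset.sum_congr rfl fun j _ => ?_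
  rw [symProd, smul_comm]

theorem replaceOne_symProd (π τ : E →ₗ[ℂ] E) {n : ℕ} (v : Fin n → E) :
    replaceOne π (SymmetricAlgebra.ι ℂ E ∘ₗ τ) (symProd v) =
      ∑ j, symProd (Function.update (fun i => π (v i)) j (τ (v j))) := by
  rw [symProd, map_smul, replaceOne_prod, Finset.smul_sum]
  refine Finset.sum_congr rfl fun j _ => ?_
  rw [symProd, ← Finset.mul_prod_erase Finset.univ _ (Finset.mem_univ j), Function.update_self]
  congr 2
  refine Finset.prod_congr rfl fun i hi => ?_
  rw [Function.update_of_ne (Finset.ne_of_mem_erase hi)]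

/-- The symmetric Fock space `Γ(E)`: the Hilbert space completion of the finite particle space. -/
abbrev FockSpace (E : Type*) [NormedAddCommGroup E] [InnerProductSpace ℂ E] : Type _ :=
  UniformSpace.Completion (FinFock E)

/-- The vacuum expectation `φ(T) = ⟪Ω, T Ω⟫` in `Γ(E)`, for an operator `T` on `Γ(E)` that is
defined on the finite particle space and leaves it invariant. -/
def vacuumExpectation (T : Module.End ℂ (FinFock E)) : ℂ :=
  inner ℂ ((vacuum : FinFock E) : FockSpace E) ((T vacuum : FinFock E) : FockSpace E)

end Algebraic

section Concrete

variable {G : Type*} [NormedAddCommGroup G] [InnerProductSpace ℂ G] [CompleteSpace G]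

/-- `ℋ = L²(ℝ⁺, 𝒢) ≅ L²(ℝ⁺) ⊗ 𝒢`. -/
abbrev OneParticle (G : Type*) [NormedAddCommGroup G] [InnerProductSpace ℂ G] : Type _ :=
  Lp G 2 (volume.restrict (Set.Ici (0 : ℝ)))

/-- The closed subspace of the multiplicity space spanned by the `e k` with `k ∈ σ`. -/
def colorSubspace (e : HilbertBasis ℕ+ ℂ G) (σ : Set ℕ+) : Submodule ℂ G :=
  (Submodule.span ℂ (e '' σ)).topologicalClosure

instance (e : HilbertBasis ℕ+ ℂ G) (σ : Set ℕ+) : CompleteSpace (colorSubspace e σ) :=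
  (Submodule.isClosed_topologicalClosure _).completeSpace_coe

/-- The canonical projection `Π^(σ)` of `ℋ` onto `ℋ^(σ)`,
`∑_k u^(k) ⊗ e_k ↦ ∑_{k ∈ σ} u^(k) ⊗ e_k`: pointwise projection onto the span of the `e k`, `k ∈ σ`. -/
def filterProj (e : HilbertBasis ℕ+ ℂ G) (σ : Set ℕ+) : OneParticle G →ₗ[ℂ] OneParticle G :=
  ((colorSubspace e σ).starProjection.compLpL 2 (volume.restrict (Set.Ici (0 : ℝ)))).toLinearMap

/-- The vector `χ_{[0,t]} ⊗ e_k` of `ℋ`. -/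
def chi (e : HilbertBasis ℕ+ ℂ G) (t : ℝ) (k : ℕ+) : OneParticle G :=
  indicatorConstLp 2 (measurableSet_Icc (a := (0 : ℝ)) (b := t))
    (((Measure.restrict_apply_le _ _).trans_lt measure_Icc_lt_top).ne) (e k)

/-- The operator `I_{[0,t]}` of multiplication by `χ_{[0,t]}` on `ℋ`. -/
def mulIndicator (G : Type*) [NormedAddCommGroup G] [InnerProductSpace ℂ G] (t : ℝ) :
    OneParticle G →ₗ[ℂ] OneParticle G where
  toFun f := ((Lp.memLp f).indicator (measurableSet_Icc (a := (0 : ℝ)) (b := t))).toLp _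
  map_add' f g := by
    ext1
    filter_upwards [((Lp.memLp (f + g)).indicator measurableSet_Icc).coeFn_toLp,
      ((Lp.memLp f).indicator (measurableSet_Icc (a := (0 : ℝ)) (b := t))).coeFn_toLp,
      ((Lp.memLp g).indicator (measurableSet_Icc (a := (0 : ℝ)) (b := t))).coeFn_toLp,
      Lp.coeFn_add f g,
      Lp.coeFn_add (((Lp.memLp f).indicator (measurableSet_Icc (a := (0 : ℝ)) (b := t))).toLp _)
        (((Lp.memLp g).indicator (measurableSet_Icc (a := (0 : ℝ)) (b := t))).toLp _)]
      with x h1 h2 h3 h4 h5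
    rw [h1, h5, Pi.add_apply, h2, h3]
    by_cases hx : x ∈ Set.Icc (0 : ℝ) t
    · simp only [Set.indicator_of_mem hx, h4, Pi.add_apply]
    · simp only [Set.indicator_of_notMem hx, add_zero]
  map_smul' c f := by
    ext1
    filter_upwards [((Lp.memLp (c • f)).indicator measurableSet_Icc).coeFn_toLp,
      ((Lp.memLp f).indicator (measurableSet_Icc (a := (0 : ℝ)) (b := t))).coeFn_toLp,
      Lp.coeFn_smul c f,
      Lp.coeFn_smul c
        (((Lp.memLp f).indicator (measurableSet_Icc (a := (0 : ℝ)) (b := t))).toLp _)]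
      with x h1 h2 h3 h4
    rw [h1, RingHom.id_apply, h4, Pi.smul_apply, h2]
    by_cases hx : x ∈ Set.Icc (0 : ℝ) t
    · simp only [Set.indicator_of_mem hx, h3, Pi.smul_apply]
    · simp only [Set.indicator_of_notMem hx, smul_zero]

/-- The operator `I_{[0,t]} ⊗ |e_k⟩⟨e_k|` on `ℋ`. -/
def numberKernel (e : HilbertBasis ℕ+ ℂ G) (t : ℝ) (k : ℕ+) : OneParticle G →ₗ[ℂ] OneParticle G :=
  mulIndicator G t ∘ₗ
    ((InnerProductSpace.rankOne ℂ (e k) (e k)).compLpL 2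
      (volume.restrict (Set.Ici (0 : ℝ)))).toLinearMap

/-- The second quantization `P^(σ) = Γ(Π^(σ))`. -/
def filterOp (e : HilbertBasis ℕ+ ℂ G) (σ : Set ℕ+) : Module.End ℂ (FinFock (OneParticle G)) :=
  secondQuantization (filterProj e σ)

/-- The filtered creation process `A_t^{(k,σ)*} = a*(χ_{[0,t]} ⊗ e_k) P^(σ)`. -/
def filteredCreation (e : HilbertBasis ℕ+ ℂ G) (t : ℝ) (k : ℕ+) (σ : Set ℕ+) :
    Module.End ℂ (FinFock (OneParticle G)) :=
  creation (chi e t k) ∘ₗ filterOp e σ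

/-- The filtered annihilation process `A_t^{(k,σ)} = P^(σ) a(χ_{[0,t]} ⊗ e_k)`. -/
def filteredAnnihilation (e : HilbertBasis ℕ+ ℂ G) (t : ℝ) (k : ℕ+) (σ : Set ℕ+) :
    Module.End ℂ (FinFock (OneParticle G)) :=
  filterOp e σ ∘ₗ annihilation (chi e t k)

/-- The filtered number process `A_t^{(k,σ)∘}`: it counts the particles of color `k` in `[0,t]`,
while all the particles that are not being counted have to pass the filter `σ`, i.e.
`v₁ ∘ ⋯ ∘ vₙ ↦ ∑ⱼ v₁^(σ) ∘ ⋯ ∘ (χ_{[0,t]} vⱼ^(k) ⊗ e_k) ∘ ⋯ ∘ vₙ^(σ)`, where `v^(σ) = Π^(σ) v`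
and `v^(k) = ⟪e_k, v(·)⟫`; see `replaceOne_symProd`. -/
def filteredNumber (e : HilbertBasis ℕ+ ℂ G) (t : ℝ) (k : ℕ+) (σ : Set ℕ+) :
    Module.End ℂ (FinFock (OneParticle G)) :=
  replaceOne (filterProj e σ) (SymmetricAlgebra.ι ℂ (OneParticle G) ∘ₗ numberKernel e t k)

/-- The filtered time process `A_t^{(0,σ)} = t P^(σ)`. -/
def filteredTime (e : HilbertBasis ℕ+ ℂ G) (t : ℝ) (σ : Set ℕ+) :
    Module.End ℂ (FinFock (OneParticle G)) :=
  (t : ℂ) • filterOp e σ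

/-- `Λ_t^{(k,σ)}`: the sum of the filtered annihilation, creation, number and time processes. -/
def filteredPoisson (e : HilbertBasis ℕ+ ℂ G) (t : ℝ) (k : ℕ+) (σ : Set ℕ+) :
    Module.End ℂ (FinFock (OneParticle G)) :=
  filteredAnnihilation e t k σ + filteredCreation e t k σ + filteredNumber e t k σ +
    filteredTime e t σ

end Concrete

/-! ### Adapted partitions -/

/-- The partition `R` of the index set is `(k, σ)`-adapted: (A1) indices in the same block have the
same color; (A2) if `i < m < j` with `i, j` in a block that does not contain `m`, then the color of
that block belongs to the filter `σ m`. -/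
def IsAdapted {n : ℕ} (k : Fin n → ℕ+) (σ : Fin n → Set ℕ+)
    (R : Finpartition (Finset.univ : Finset (Fin n))) : Prop :=
  (∀ B ∈ R.parts, ∀ i ∈ B, ∀ j ∈ B, k i = k j) ∧
    ∀ B ∈ R.parts, ∀ i ∈ B, ∀ j ∈ B, ∀ m ∉ B, i < m → m < j → k i ∈ σ m

open Classical in
/-- The set `𝒫ₙ(k, σ)` of all `(k, σ)`-adapted partitions of `{1, …, n}`. -/
def adaptedPartitions {n : ℕ} (k : Fin n → ℕ+) (σ : Fin n → Set ℕ+) :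
    Finset (Finpartition (Finset.univ : Finset (Fin n))) :=
  Finset.univ.filter (IsAdapted k σ)

end

end FilteredFock

/-! In the symmetric algebra Ω is 1, and all vectors reached from Ω are polynomials in the particles
χ_j = χ_{[0,t]} ⊗ e_j. On these, Λ^{(k,σ)} is x ↦ (t + χ_k) Γ(x) + D(x). Here Γ = P^(σ) is the
algebra homomorphism fixing χ_j for j ∈ σ and killing the other χ_j, and D, the sum of the
annihilation and number parts, is a derivation twisted by Γ with D(1) = 0 and D(χ_j) = δ_{jk} (t +
χ_k).

The product acts on Ω from right to left. The indices s already used give a sum over partitions of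
s, in which a block contributes t if it is finished and χ_j if it still waits for an index further
left. A new index a opens the block {a} through the prefactor t + χ_k, or joins one waiting block of
color k through the Leibniz rule for D; either way the block may then be finished or wait again. On
the other blocks Γ acts: finished ones pass freely, waiting ones need their color in σ_a, which is
(A2) for m = a.

`Finpartition.sum_prod_parts_insert` enumerates these choices and `filteredPoisson_sum_blockValue`
is the resulting induction step. The vacuum coefficient finally discards every χ_j, so that exactly
the partitions with all blocks closed survive, each with one factor t per block. -/

namespace Finpartition

/-! ### Partitions of a set enlarged by one point -/

variable {α : Type*} [DecidableEq α] {a : α} {s : Finset α}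

/-- The partition of `insert a s` obtained from a partition of `s` by adding `a` to the block `C`,
or as a block of its own if `C = ∅`. -/
def insertInto (R : Finpartition s) (ha : a ∉ s) (C : Finset α) (hC : C ∈ insert ∅ R.parts) :
    Finpartition (insert a s) :=
  ofExistsUnique (insert (insert a C) (R.parts.erase C))
    (by
      intro p hp
      rcases Finset.mem_insert.1 hp with rfl | hp
      · refine Finset.insert_subset_insert _ ?_
        rcases Finset.mem_insert.1 hC with rfl | hC
        · exact Finset.empty_subset _
        · exact R.subset hC
      · exact (R.subset (Finset.mem_of_mem_erase hp)).trans (Finset.subset_insert _ _))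
    (by
      intro x hx
      by_cases hxC : x ∈ insert a C
      · refine ⟨insert a C, ⟨Finset.mem_insert_self _ _, hxC⟩, ?_⟩
        rintro q ⟨hq, hxq⟩
        rcases Finset.mem_insert.1 hq with rfl | hq
        · rfl
        · obtain ⟨hqC, hq'⟩ := Finset.mem_erase.1 hq
          exfalso
          rcases Finset.mem_insert.1 hxC with rfl | hxC
          · exact ha (R.subset hq' hxq)
          · rcases Finset.mem_insert.1 hC with rfl | hC
            · simp at hxC
            · exact hqC (R.eq_of_mem_parts hq' hC hxq hxC)
      · have hxs : x ∈ s := by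
          rcases Finset.mem_insert.1 hx with rfl | hx
          · simp at hxC
          · exact hx
        obtain ⟨q, hq, hxq⟩ := R.exists_mem hxs
        refine ⟨q, ⟨Finset.mem_insert_of_mem (Finset.mem_erase.2 ⟨?_, hq⟩), hxq⟩, ?_⟩
        · rintro rfl
          exact hxC (Finset.mem_insert_of_mem hxq)
        · rintro p ⟨hp, hxp⟩
          rcases Finset.mem_insert.1 hp with rfl | hp
          · exact absurd hxp hxC
          · exact R.eq_of_mem_parts (Finset.mem_of_mem_erase hp) hq hxp hxq)
    (by
      intro h
      rcases Finset.mem_insert.1 h with h | h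
      · exact (Finset.insert_ne_empty a C) h.symm
      · exact R.empty_notMem_parts (Finset.mem_of_mem_erase h))

theorem parts_insertInto (R : Finpartition s) (ha : a ∉ s) (C : Finset α)
    (hC : C ∈ insert ∅ R.parts) :
    (R.insertInto ha C hC).parts = insert (insert a C) (R.parts.erase C) := rfl

theorem notMem_of_mem_insert_parts (R : Finpartition s) (ha : a ∉ s) {C : Finset α}
    (hC : C ∈ insert ∅ R.parts) : a ∉ C := by
  rcases Finset.mem_insert.1 hC with rfl | hC
  · simp
  · exact fun h => ha (R.subset hC h)

theorem part_insertInto (R : Finpartition s) (ha : a ∉ s) (C : Finset α)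
    (hC : C ∈ insert ∅ R.parts) : (R.insertInto ha C hC).part a = insert a C :=
  part_eq_of_mem _ (by simp [parts_insertInto]) (by simp)

/-- Nonemptiness excludes the trace of the block {a}, which leaves nothing behind on `s`. -/
theorem mem_parts_restrict_insert (R : Finpartition (insert a s)) (ha : a ∉ s) {B : Finset α} :
    B ∈ (R.restrict (Finset.subset_insert a s)).parts ↔
      B ≠ ∅ ∧ ∃ B' ∈ R.parts, B'.erase a = B := by
  have h : ∀ B' ∈ R.parts, B' ⊓ s = B'.erase a := fun B' hB' => by
    ext x
    have hx : x ∈ B' → x ∈ insert a s := fun h => R.subset hB' h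
    simp only [Finset.inf_eq_inter, Finset.mem_inter, Finset.mem_erase, Finset.mem_insert] at *
    constructor
    · rintro ⟨h1, h2⟩
      exact ⟨fun h => ha (h ▸ h2), h1⟩
    · rintro ⟨h1, h2⟩
      exact ⟨h2, (hx h2).resolve_left h1⟩
  simp only [restrict, Finset.bot_eq_empty, Finset.mem_erase, Finset.mem_image]
  refine and_congr_right fun _ => exists_congr fun B' => and_congr_right fun hB' => ?_
  rw [h B' hB']

theorem restrict_insertInto (R : Finpartition s) (ha : a ∉ s) (C : Finset α)
    (hC : C ∈ insert ∅ R.parts) :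
    (R.insertInto ha C hC).restrict (Finset.subset_insert a s) = R := by
  have haC := R.notMem_of_mem_insert_parts ha hC
  have hp : ∀ B ∈ R.parts, B.erase a = B := fun B hB =>
    Finset.erase_eq_of_notMem fun h => ha (R.subset hB h)
  ext B
  rw [mem_parts_restrict_insert _ ha, parts_insertInto]
  constructor
  · rintro ⟨hB, B', hB', rfl⟩
    rcases Finset.mem_insert.1 hB' with rfl | hB'
    -- The trace of the new block is `C` itself; being nonempty, it must be one of the parts.
    · rw [Finset.erase_insert haC] at hB ⊢
      exact (Finset.mem_insert.1 hC).resolve_left hB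
    · rw [hp _ (Finset.mem_of_mem_erase hB')]
      exact Finset.mem_of_mem_erase hB'
  · intro hB
    refine ⟨R.ne_empty hB, ?_⟩
    by_cases h : B = C
    · exact ⟨insert a C, Finset.mem_insert_self _ _, by rw [Finset.erase_insert haC, h]⟩
    · exact ⟨B, Finset.mem_insert_of_mem (Finset.mem_erase.2 ⟨h, hB⟩), hp B hB⟩

theorem part_erase_mem (R : Finpartition (insert a s)) (ha : a ∉ s) :
    (R.part a).erase a ∈ insert ∅ (R.restrict (Finset.subset_insert a s)).parts := by
  rw [Finset.mem_insert, mem_parts_restrict_insert _ ha]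
  by_cases h : (R.part a).erase a = ∅
  · exact Or.inl h
  · exact Or.inr ⟨h, _, R.part_mem.2 (Finset.mem_insert_self _ _), rfl⟩

theorem insertInto_restrict (R : Finpartition (insert a s)) (ha : a ∉ s) :
    (R.restrict (Finset.subset_insert a s)).insertInto ha ((R.part a).erase a)
      (R.part_erase_mem ha) = R := by
  have hpa : R.part a ∈ R.parts := R.part_mem.2 (Finset.mem_insert_self _ _)
  have haa : a ∈ R.part a := R.mem_part_self.2 (Finset.mem_insert_self _ _)
  have hne : ∀ B ∈ R.parts, B ≠ R.part a → B.erase a = B := fun B hB h =>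
    Finset.erase_eq_of_notMem fun haB => h (R.eq_of_mem_parts hB hpa haB haa)
  ext B
  rw [parts_insertInto, Finset.insert_erase haa, Finset.mem_insert, Finset.mem_erase,
    mem_parts_restrict_insert _ ha]
  constructor
  · rintro (rfl | ⟨h1, -, B', hB', rfl⟩)
    · exact hpa
    · have : B' ≠ R.part a := fun h => h1 (by rw [h])
      rwa [hne B' hB' this]
  · intro hB
    by_cases h : B = R.part a
    · exact Or.inl h
    · refine Or.inr ⟨fun h' => ?_, R.ne_empty hB, B, hB, hne B hB h⟩
      obtain ⟨x, hx⟩ := R.nonempty_of_mem_parts hB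
      exact h (R.eq_of_mem_parts hB hpa hx (Finset.mem_of_mem_erase (h' ▸ hx)))

/-- A sum over the partitions of `insert a s`, organized by the partition induced on `s`. -/
theorem sum_prod_parts_insert {A : Type*} [CommSemiring A] (ha : a ∉ s) (f : Finset α → A) :
    ∑ R : Finpartition (insert a s), ∏ B ∈ R.parts, f B =
      ∑ R : Finpartition s, (f {a} * ∏ B ∈ R.parts, f B +
        ∑ C ∈ R.parts, f (insert a C) * ∏ B ∈ R.parts.erase C, f B) := by
  have h : ∀ R : Finpartition s, f {a} * ∏ B ∈ R.parts, f B +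
        ∑ C ∈ R.parts, f (insert a C) * ∏ B ∈ R.parts.erase C, f B =
      ∑ C ∈ insert ∅ R.parts, f (insert a C) * ∏ B ∈ R.parts.erase C, f B := fun R => by
    -- A new singleton counts as joining `a` to the empty block: ∅ is not a part, so erasing it
    -- changes nothing.
    rw [Finset.sum_insert R.empty_notMem_parts,
      Finset.erase_eq_of_notMem R.empty_notMem_parts, insert_empty_eq]
  rw [Finset.sum_congr rfl fun R _ => h R, Finset.sum_sigma']
  symm
  refine Finset.sum_bij'
    (fun x hx => x.1.insertInto ha x.2 (Finset.mem_sigma.1 hx).2)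
    (fun R _ => ⟨R.restrict (Finset.subset_insert a s), (R.part a).erase a⟩)
    (fun _ _ => Finset.mem_univ _)
    (fun R _ => Finset.mem_sigma.2 ⟨Finset.mem_univ _, R.part_erase_mem ha⟩)
    ?_ (fun R _ => R.insertInto_restrict ha) ?_
  · rintro ⟨R, C⟩ hx
    have hC := (Finset.mem_sigma.1 hx).2
    simp only
    rw [restrict_insertInto, part_insertInto,
      Finset.erase_insert (R.notMem_of_mem_insert_parts ha hC)]
  · rintro ⟨R, C⟩ hx
    rw [parts_insertInto, Finset.prod_insert]
    -- The enlarged block cannot be among the remaining parts, since these lie in `s` and `a ∉ s`.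
    intro h
    exact ha (R.subset (Finset.mem_of_mem_erase h) (Finset.mem_insert_self _ _))

end Finpartition

/-! ### One-particle operators on the vectors χ_{[0,t]} ⊗ e_k -/

namespace FilteredFock

variable {G : Type*} [NormedAddCommGroup G] [InnerProductSpace ℂ G]

/-- An operator acting pointwise in `G` only changes the constant value on [0,t], which reduces the
next computations to basis vectors of `G`. -/
theorem compLpL_chi (L : G →L[ℂ] G) (e : HilbertBasis ℕ+ ℂ G) (t : ℝ) (k : ℕ+) :
    L.compLpL 2 (volume.restrict (Set.Ici (0 : ℝ))) (chi e t k) =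
      indicatorConstLp 2 (measurableSet_Icc (a := (0 : ℝ)) (b := t))
        (((Measure.restrict_apply_le _ _).trans_lt measure_Icc_lt_top).ne) (L (e k)) := by
  ext1
  refine (L.coeFn_compLpL _).trans ?_
  filter_upwards [indicatorConstLp_coeFn (p := 2) (c := e k)
      (hs := measurableSet_Icc (a := (0 : ℝ)) (b := t))
      (hμs := (((Measure.restrict_apply_le (μ := volume) (Set.Ici (0 : ℝ)) _).trans_lt
        measure_Icc_lt_top).ne)),
    indicatorConstLp_coeFn (p := 2) (c := L (e k))
      (hs := measurableSet_Icc (a := (0 : ℝ)) (b := t))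
      (hμs := (((Measure.restrict_apply_le (μ := volume) (Set.Ici (0 : ℝ)) _).trans_lt
        measure_Icc_lt_top).ne))] with x h1 h2
  rw [h2, chi, h1]
  by_cases hx : x ∈ Set.Icc (0 : ℝ) t <;> simp [hx]

theorem indicatorConstLp_zero' {α E : Type*} {m : MeasurableSpace α} {p : ENNReal} {μ : Measure α}
    [NormedAddCommGroup E] {s : Set α} (hs : MeasurableSet s) (hμs : μ s ≠ ⊤) :
    indicatorConstLp p hs hμs (0 : E) = 0 := by
  ext1
  filter_upwards [indicatorConstLp_coeFn (p := p) (c := (0 : E)) (hs := hs) (hμs := hμs),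
    Lp.coeFn_zero E p μ] with x h1 h2
  rw [h1, h2]
  simp

theorem mulIndicator_chi (e : HilbertBasis ℕ+ ℂ G) (t : ℝ) (k : ℕ+) :
    mulIndicator G t (chi e t k) = chi e t k := by
  ext1
  refine ((Lp.memLp (chi e t k)).indicator
    (measurableSet_Icc (a := (0 : ℝ)) (b := t))).coeFn_toLp.trans ?_
  filter_upwards [indicatorConstLp_coeFn (p := 2) (c := e k)
      (hs := measurableSet_Icc (a := (0 : ℝ)) (b := t))
      (hμs := (((Measure.restrict_apply_le (μ := volume) (Set.Ici (0 : ℝ)) _).trans_lt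
        measure_Icc_lt_top).ne))] with x h1
  by_cases hx : x ∈ Set.Icc (0 : ℝ) t
  · simp [hx]
  · rw [Set.indicator_of_notMem hx, chi, h1, Set.indicator_of_notMem hx]

theorem numberKernel_chi (e : HilbertBasis ℕ+ ℂ G) (t : ℝ) (k j : ℕ+) :
    numberKernel e t k (chi e t j) = if j = k then chi e t k else 0 := by
  rw [numberKernel, LinearMap.comp_apply, ContinuousLinearMap.coe_coe, compLpL_chi,
    InnerProductSpace.rankOne_apply, orthonormal_iff_ite.1 e.orthonormal k j]
  split_ifs with h1 h2 h2
  · rw [one_smul]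
    exact mulIndicator_chi e t k
  · exact absurd h1.symm h2
  · exact absurd h2.symm h1
  · rw [zero_smul, indicatorConstLp_zero', map_zero]

variable [CompleteSpace G]

/-- The value `t` is the length of [0,t], and this is where `0 ≤ t` enters: for negative `t` the
interval is empty. -/
theorem inner_chi (e : HilbertBasis ℕ+ ℂ G) {t : ℝ} (ht : 0 ≤ t) (k j : ℕ+) :
    inner ℂ (chi e t k) (chi e t j) = if j = k then (t : ℂ) else 0 := by
  have hv : (volume.restrict (Set.Ici (0 : ℝ))).real (Set.Icc (0 : ℝ) t) = t := by
    rw [measureReal_restrict_apply measurableSet_Icc,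
      Set.inter_eq_left.2 Set.Icc_subset_Ici_self]
    simp [ht]
  have hne : (volume.restrict (Set.Ici (0 : ℝ))) (Set.Icc (0 : ℝ) t) ≠ ⊤ :=
    ((Measure.restrict_apply_le _ _).trans_lt measure_Icc_lt_top).ne
  rw [chi, chi, L2.inner_indicatorConstLp_indicatorConstLp _ _ hne hne, Set.inter_self, hv,
    orthonormal_iff_ite.1 e.orthonormal k j]
  simp [eq_comm]

theorem filterProj_chi (e : HilbertBasis ℕ+ ℂ G) (t : ℝ) (σ : Set ℕ+) [DecidablePred (· ∈ σ)]
    (j : ℕ+) : filterProj e σ (chi e t j) = if j ∈ σ then chi e t j else 0 := by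
  rw [filterProj, ContinuousLinearMap.coe_coe, compLpL_chi]
  split_ifs with h
  · have : (colorSubspace e σ).starProjection (e j) = e j :=
      Submodule.starProjection_eq_self_iff.2
        (Submodule.le_topologicalClosure _ (Submodule.subset_span ⟨j, h, rfl⟩))
    rw [this, chi]
  · have : (colorSubspace e σ).starProjection (e j) = 0 := by
      -- A subspace and its closure have the same orthogonal complement, so orthogonality need only
      -- be tested on the spanning basis vectors.
      rw [Submodule.starProjection_apply_eq_zero_iff, colorSubspace,
        Submodule.orthogonal_closure, Submodule.mem_orthogonal]
      intro u hu
      induction hu using Submodule.span_induction with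
      | mem x hx =>
        obtain ⟨i, hi, rfl⟩ := hx
        exact e.orthonormal.2 fun hij => h (hij ▸ hi)
      | zero => simp
      | add x y _ _ hx hy => rw [inner_add_left, hx, hy, add_zero]
      | smul c x _ hx => rw [inner_smul_left, hx, mul_zero]
    rw [this, indicatorConstLp_zero']

end FilteredFock

namespace FilteredFock

/-! ### The filtered Poisson operators as twisted derivations -/

section Operators

variable {E : Type*} [NormedAddCommGroup E] [InnerProductSpace ℂ E]

theorem secondQuantization_mul (π : E →ₗ[ℂ] E) (x y : FinFock E) :
    secondQuantization π (x * y) = secondQuantization π x * secondQuantization π y := by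
  simp [secondQuantization]

theorem secondQuantization_algebraMap (π : E →ₗ[ℂ] E) (c : ℂ) :
    secondQuantization π (algebraMap ℂ _ c) = algebraMap ℂ _ c := by
  simp [secondQuantization]

theorem secondQuantization_ι (π : E →ₗ[ℂ] E) (v : E) :
    secondQuantization π (SymmetricAlgebra.ι ℂ E v) = SymmetricAlgebra.ι ℂ E (π v) := by
  simp [secondQuantization]

theorem secondQuantization_finsetProd {α : Type*} (π : E →ₗ[ℂ] E) (s : Finset α)
    (f : α → FinFock E) :
    secondQuantization π (∏ i ∈ s, f i) = ∏ i ∈ s, secondQuantization π (f i) := by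
  simp [secondQuantization, map_prod]

variable {G : Type*} [NormedAddCommGroup G] [InnerProductSpace ℂ G] [CompleteSpace G]
  (e : HilbertBasis ℕ+ ℂ G) (t : ℝ) (k : ℕ+) (σ : Set ℕ+)

/-- The vector `χ_{[0,t]} ⊗ e_k` as an element of the finite particle space. -/
noncomputable def chiFock (k : ℕ+) : FinFock (OneParticle G) :=
  SymmetricAlgebra.ι ℂ (OneParticle G) (chi e t k)

/-- The sum of the filtered annihilation and number processes. -/
noncomputable def filteredLowering : Module.End ℂ (FinFock (OneParticle G)) :=
  filteredAnnihilation e t k σ + filteredNumber e t k σ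

/-- Time and creation are both multiplications performed after the filter; what remains is the
twisted derivation. -/
theorem filteredPoisson_apply (x : FinFock (OneParticle G)) :
    filteredPoisson e t k σ x =
      (algebraMap ℂ _ (t : ℂ) + chiFock e t k) * filterOp e σ x + filteredLowering e t k σ x := by
  simp only [filteredPoisson, filteredLowering, filteredTime, filteredCreation, creation,
    LinearMap.add_apply, LinearMap.comp_apply, LinearMap.smul_apply, LinearMap.mulLeft_apply,
    chiFock]
  rw [Algebra.smul_def (t : ℂ) (filterOp e σ x)]
  ring

/-- The annihilator is a derivation, and following it by the homomorphism P^(σ) twists it; the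
number part obeys the same twisted rule by `replaceOne_mul`. -/
theorem filteredLowering_mul (x y : FinFock (OneParticle G)) :
    filteredLowering e t k σ (x * y) =
      filteredLowering e t k σ x * filterOp e σ y +
        filterOp e σ x * filteredLowering e t k σ y := by
  simp only [filteredLowering, filteredAnnihilation, filteredNumber, filterOp,
    LinearMap.add_apply, LinearMap.comp_apply, annihilation_mul, replaceOne_mul,
    secondQuantization_mul, map_add]
  ring

theorem filteredLowering_algebraMap (c : ℂ) :
    filteredLowering e t k σ (algebraMap ℂ _ c) = 0 := by
  simp only [filteredLowering, filteredAnnihilation, filteredNumber, LinearMap.add_apply,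
    LinearMap.comp_apply, annihilation_algebraMap, map_zero, zero_add]
  rw [Algebra.algebraMap_eq_smul_one, map_smul, replaceOne_one, smul_zero]

/-- Annihilation yields `t` and the number process yields the particle back. The sum equals the
prefactor in `filteredPoisson_apply`, so a continued block has the same two futures as a new one. -/
theorem filteredLowering_chiFock (ht : 0 ≤ t) (j : ℕ+) :
    filteredLowering e t k σ (chiFock e t j) =
      if j = k then algebraMap ℂ _ (t : ℂ) + chiFock e t k else 0 := by
  simp only [filteredLowering, filteredAnnihilation, filteredNumber, chiFock, filterOp,
    LinearMap.add_apply, LinearMap.comp_apply, annihilation_ι, replaceOne_ι,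
    secondQuantization_algebraMap, inner_chi e ht, numberKernel_chi]
  split_ifs <;> simp

theorem filterOp_chiFock [DecidablePred (· ∈ σ)] (j : ℕ+) :
    filterOp e σ (chiFock e t j) = if j ∈ σ then chiFock e t j else 0 := by
  rw [filterOp, chiFock, secondQuantization_ι, filterProj_chi]
  split_ifs <;> simp

theorem filteredLowering_prod {α : Type*} [DecidableEq α] (s : Finset α)
    (f : α → FinFock (OneParticle G)) :
    filteredLowering e t k σ (∏ i ∈ s, f i) =
      ∑ j ∈ s, filteredLowering e t k σ (f j) * ∏ i ∈ s.erase j, filterOp e σ (f i) := by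
  induction s using Finset.induction_on with
  | empty =>
    rw [Finset.prod_empty, Finset.sum_empty, ← map_one (algebraMap ℂ _)]
    exact filteredLowering_algebraMap e t k σ 1
  | insert a s ha ih =>
    rw [Finset.prod_insert ha, filteredLowering_mul, ih, filterOp, secondQuantization_finsetProd,
      Finset.sum_insert ha, Finset.erase_insert ha, Finset.mul_sum]
    congr 1
    refine Finset.sum_congr rfl fun j hj => ?_
    have hja : j ≠ a := fun h => ha (h ▸ hj)
    rw [Finset.erase_insert_of_ne hja.symm, Finset.prod_insert (by simp [ha])]
    ring

theorem filteredPoisson_prod {α : Type*} [DecidableEq α] (s : Finset α)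
    (f : α → FinFock (OneParticle G)) :
    filteredPoisson e t k σ (∏ i ∈ s, f i) =
      (algebraMap ℂ _ (t : ℂ) + chiFock e t k) * ∏ i ∈ s, filterOp e σ (f i) +
        ∑ j ∈ s, filteredLowering e t k σ (f j) * ∏ i ∈ s.erase j, filterOp e σ (f i) := by
  rw [filteredPoisson_apply, filteredLowering_prod, filterOp, secondQuantization_finsetProd]

end Operators

/-! ### Expansion of the vectors `Λ ⋯ Λ Ω` over partitions with open blocks -/

section Blocks

variable {ι : Type*} (k : ι → ℕ+) (σ : ι → Set ℕ+)

/-- The common color of the elements of a monochromatic block. -/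
noncomputable def blockColor (B : Finset ι) : ℕ+ :=
  open Classical in if h : B.Nonempty then k h.choose else 1

theorem blockColor_eq {k : ι → ℕ+} {B : Finset ι} (hB : ∀ i ∈ B, ∀ j ∈ B, k i = k j) {i : ι} (hi : i ∈ B) :
    blockColor k B = k i := by
  have h : B.Nonempty := ⟨i, hi⟩
  rw [blockColor, dif_pos h]
  exact hB _ h.choose_spec _ hi

variable [LinearOrder ι]

/-- The block `B` is monochromatic, and passes all filters at indices of `s` which it nests. -/
def IsClosedBlock (s B : Finset ι) : Prop :=
  (∀ i ∈ B, ∀ j ∈ B, k i = k j) ∧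
    ∀ i ∈ B, ∀ j ∈ B, ∀ m ∈ s, m ∉ B → i < m → m < j → k i ∈ σ m

/-- The block `B` is monochromatic, and passes all filters at indices of `s` below its maximum:
the condition for a block that will be continued to the left of `s`. -/
def IsOpenBlock (s B : Finset ι) : Prop :=
  (∀ i ∈ B, ∀ j ∈ B, k i = k j) ∧ ∀ j ∈ B, ∀ m ∈ s, m ∉ B → m < j → k j ∈ σ m

variable {k σ} {a : ι} {s B : Finset ι}

theorem isClosedBlock_singleton : IsClosedBlock k σ s {a} := by
  refine ⟨by simp, ?_⟩
  simp only [Finset.mem_singleton]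
  rintro i rfl j rfl m - - h1 h2
  exact absurd h2 h1.not_gt

theorem isOpenBlock_insert_singleton (ha : ∀ i ∈ s, a < i) :
    IsOpenBlock k σ (insert a s) {a} := by
  refine ⟨by simp, ?_⟩
  simp only [Finset.mem_singleton]
  rintro j rfl m hm hma h
  exact absurd h (ha m ((Finset.mem_insert.1 hm).resolve_left hma)).not_gt

/-- An index to the left of everything is never nested inside `B`. -/
theorem isClosedBlock_insert_left (ha : ∀ i ∈ s, a < i) (hB : B ⊆ s) :
    IsClosedBlock k σ (insert a s) B ↔ IsClosedBlock k σ s B := by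
  refine and_congr_right fun _ => ⟨fun h i hi j hj m hm => h i hi j hj m
    (Finset.mem_insert_of_mem hm), fun h i hi j hj m hm hmB him hmj => ?_⟩
  rcases Finset.mem_insert.1 hm with rfl | hm
  · exact absurd him (ha i (hB hi)).not_gt
  · exact h i hi j hj m hm hmB him hmj

/-- Since `a` lies below all of `B`, any later continuation of `B` to the left will nest `a`; hence
the one extra filter condition. -/
theorem isOpenBlock_insert_left (ha : ∀ i ∈ s, a < i) (hB : B ⊆ s) (hne : B.Nonempty) :
    IsOpenBlock k σ (insert a s) B ↔ IsOpenBlock k σ s B ∧ blockColor k B ∈ σ a := by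
  obtain ⟨i, hi⟩ := hne
  have haB : a ∉ B := fun h => lt_irrefl a (ha a (hB h))
  constructor
  · rintro ⟨h1, h2⟩
    refine ⟨⟨h1, fun j hj m hm => h2 j hj m (Finset.mem_insert_of_mem hm)⟩, ?_⟩
    rw [blockColor_eq h1 hi]
    exact h2 i hi a (Finset.mem_insert_self _ _) haB (ha i (hB hi))
  · rintro ⟨⟨h1, h2⟩, h3⟩
    refine ⟨h1, fun j hj m hm hmB hmj => ?_⟩
    rcases Finset.mem_insert.1 hm with rfl | hm
    · rwa [← blockColor_eq h1 hj]
    · exact h2 j hj m hm hmB hmj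

theorem monochromatic_insert (hne : B.Nonempty) :
    (∀ i ∈ insert a B, ∀ j ∈ insert a B, k i = k j) ↔
      (∀ i ∈ B, ∀ j ∈ B, k i = k j) ∧ blockColor k B = k a := by
  obtain ⟨i₀, hi₀⟩ := hne
  constructor
  · intro h
    have h1 : ∀ i ∈ B, ∀ j ∈ B, k i = k j := fun i hi j hj =>
      h i (Finset.mem_insert_of_mem hi) j (Finset.mem_insert_of_mem hj)
    exact ⟨h1, (blockColor_eq h1 hi₀).trans
      (h _ (Finset.mem_insert_of_mem hi₀) _ (Finset.mem_insert_self _ _))⟩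
  · rintro ⟨h1, h2⟩
    have h3 : ∀ i ∈ insert a B, k i = k a := fun i hi => by
      rcases Finset.mem_insert.1 hi with rfl | hi
      · rfl
      · rw [← h2, blockColor_eq h1 hi]
    exact fun i hi j hj => (h3 i hi).trans (h3 j hj).symm

/-- Once in the block, `a` imposes no filter, and as a member it meets none because no index of `s`
lies below it; only the color must match. -/
theorem isOpenBlock_insert_insert (ha : ∀ i ∈ s, a < i) (hne : B.Nonempty) :
    IsOpenBlock k σ (insert a s) (insert a B) ↔ IsOpenBlock k σ s B ∧ blockColor k B = k a := by
  rw [IsOpenBlock, monochromatic_insert hne, IsOpenBlock, and_right_comm]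
  refine and_congr_left fun _ => and_congr_right fun _ => ?_
  constructor
  · intro h j hj m hm hmB hmj
    refine h j (Finset.mem_insert_of_mem hj) m (Finset.mem_insert_of_mem hm) ?_ hmj
    simp [hmB, (ha m hm).ne']
  · intro h j hj m hm hmB hmj
    obtain ⟨hma, hmB⟩ : m ≠ a ∧ m ∉ B := by simpa using hmB
    have hms := (Finset.mem_insert.1 hm).resolve_left hma
    rcases Finset.mem_insert.1 hj with rfl | hj
    · exact absurd hmj (ha m hms).not_gt
    · exact h j hj m hms hmB hmj

/-- With `a` as left end, the indices nested by the longer block are exactly those of `s` outside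
`B` and below some element of `B`, which is what openness of `B` controls. -/
theorem isClosedBlock_insert_insert (ha : ∀ i ∈ s, a < i) (hne : B.Nonempty) :
    IsClosedBlock k σ (insert a s) (insert a B) ↔
      IsOpenBlock k σ s B ∧ blockColor k B = k a := by
  rw [IsClosedBlock, monochromatic_insert hne, IsOpenBlock, and_right_comm]
  refine and_congr_left fun h2 => and_congr_right fun h1 => ?_
  constructor
  · intro h j hj m hm hmB hmj
    rw [← blockColor_eq h1 hj, h2]
    refine h a (Finset.mem_insert_self _ _) j (Finset.mem_insert_of_mem hj) m
      (Finset.mem_insert_of_mem hm) ?_ (ha m hm) hmj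
    simp [hmB, (ha m hm).ne']
  · intro h i hi j hj m hm hmB him hmj
    obtain ⟨hma, hmB⟩ : m ≠ a ∧ m ∉ B := by simpa using hmB
    have hms := (Finset.mem_insert.1 hm).resolve_left hma
    have hjB : j ∈ B := by
      rcases Finset.mem_insert.1 hj with rfl | hj
      · exact absurd hmj (ha m hms).not_gt
      · exact hj
    rw [(monochromatic_insert ⟨j, hjB⟩).2 ⟨h1, h2⟩ i hi j hj]
    exact h j hjB m hms hmB hmj

variable {G : Type*} [NormedAddCommGroup G] [InnerProductSpace ℂ G]
  (e : HilbertBasis ℕ+ ℂ G) (t : ℝ)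

variable (k σ s B) in
/-- The contribution of a block to the vector `∏_{i ∈ s} Λ_t^{(k i, σ i)} Ω`: a factor `t` if it
is closed, and a particle of its color if it is still open. -/
noncomputable def blockValue : FinFock (OneParticle G) :=
  open Classical in
  -- The cases overlap: an open block is also closed, so the value is 0, `t` or `t` plus a particle.
  (if IsClosedBlock k σ s B then algebraMap ℂ _ (t : ℂ) else 0) +
    if IsOpenBlock k σ s B then chiFock e t (blockColor k B) else 0

theorem blockValue_singleton (ha : ∀ i ∈ s, a < i) :
    blockValue k σ (insert a s) {a} e t = algebraMap ℂ _ (t : ℂ) + chiFock e t (k a) := by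
  have h := isOpenBlock_insert_singleton (k := k) (σ := σ) ha
  rw [blockValue, if_pos isClosedBlock_singleton, if_pos h,
    blockColor_eq h.1 (Finset.mem_singleton_self a)]

variable [CompleteSpace G]

/-- The filter fixes scalars and tests particles, just as a new index outside `B` leaves closedness
alone and tests openness. -/
theorem filterOp_blockValue (ha : ∀ i ∈ s, a < i) (hB : B ⊆ s) (hne : B.Nonempty) :
    filterOp e (σ a) (blockValue k σ s B e t) = blockValue k σ (insert a s) B e t := by
  classical
  have h : ∀ c : ℂ, filterOp e (σ a) (algebraMap ℂ _ c) = algebraMap ℂ _ c :=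
    secondQuantization_algebraMap _
  simp only [blockValue, isClosedBlock_insert_left ha hB, isOpenBlock_insert_left ha hB hne,
    map_add, apply_ite (filterOp e (σ a)), h, filterOp_chiFock, map_zero, ite_and]

/-- The scalar part is killed, so only an open block can be continued. A particle of color `k a`
becomes `t` plus a particle, since the longer block is closed and open under one and the same
condition. -/
theorem filteredLowering_blockValue (ht : 0 ≤ t) (ha : ∀ i ∈ s, a < i)
    (hne : B.Nonempty) :
    filteredLowering e t (k a) (σ a) (blockValue k σ s B e t) =
      blockValue k σ (insert a s) (insert a B) e t := by
  classical
  have hcol : IsOpenBlock k σ s B ∧ blockColor k B = k a →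
      blockColor k (insert a B) = k a := fun h =>
    blockColor_eq ((isOpenBlock_insert_insert ha hne).2 h).1 (Finset.mem_insert_self _ _)
  simp only [blockValue, isClosedBlock_insert_insert ha hne,
    isOpenBlock_insert_insert ha hne, map_add, apply_ite (filteredLowering e t (k a) (σ a)),
    filteredLowering_algebraMap, filteredLowering_chiFock e t _ _ ht, map_zero]
  by_cases h1 : IsOpenBlock k σ s B <;> by_cases h2 : blockColor k B = k a
  · simp [h1, h2, hcol ⟨h1, h2⟩]
  all_goals simp [h1, h2]

/-- For each partition of `s`, the prefactor term is the new block {a} and the Leibniz term at `C`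
is the joining of `a` to `C`. -/
theorem filteredPoisson_sum_blockValue (ht : 0 ≤ t) (ha : ∀ i ∈ s, a < i) :
    filteredPoisson e t (k a) (σ a)
        (∑ R : Finpartition s, ∏ B ∈ R.parts, blockValue k σ s B e t) =
      ∑ R : Finpartition (insert a s), ∏ B ∈ R.parts, blockValue k σ (insert a s) B e t := by
  have has : a ∉ s := fun h => lt_irrefl a (ha a h)
  rw [Finpartition.sum_prod_parts_insert has, map_sum]
  refine Finset.sum_congr rfl fun R _ => ?_
  have hf : ∀ B ∈ R.parts, filterOp e (σ a) (blockValue k σ s B e t) =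
      blockValue k σ (insert a s) B e t := fun B hB =>
    filterOp_blockValue e t ha (R.subset hB) (R.nonempty_of_mem_parts hB)
  rw [filteredPoisson_prod, blockValue_singleton e t ha, Finset.prod_congr rfl hf]
  congr 1
  refine Finset.sum_congr rfl fun C hC => ?_
  rw [filteredLowering_blockValue e t ht ha (R.nonempty_of_mem_parts hC)]
  congr 1
  exact Finset.prod_congr rfl fun B hB => hf B (Finset.mem_of_mem_erase hB)

/-- The head of an increasing list is its least index and its operator acts last, so each step adds
an index to the left of all earlier ones. -/
theorem prod_filteredPoisson_one (ht : 0 ≤ t) (l : List ι) (hl : l.SortedLT) :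
    (l.map fun i => filteredPoisson e t (k i) (σ i)).prod 1 =
      ∑ R : Finpartition l.toFinset, ∏ B ∈ R.parts, blockValue k σ l.toFinset B e t := by
  induction l with
  | nil =>
    -- Written as `⊥`, the empty set has a unique partition, whose empty product is the vacuum.
    change (1 : FinFock (OneParticle G)) =
      ∑ R : Finpartition (⊥ : Finset ι), ∏ B ∈ R.parts, blockValue k σ ⊥ B e t
    rw [Fintype.sum_unique]
    rfl
  | cons a l ih =>
    obtain ⟨h1, h2⟩ := List.pairwise_cons.1 hl.pairwise
    rw [List.map_cons, List.prod_cons, Module.End.mul_apply, ih h2.sortedLT,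
      filteredPoisson_sum_blockValue e t ht (fun i hi => h1 i (List.mem_toFinset.1 hi)),
      List.toFinset_cons]

end Blocks

/-! ### Passage to the vacuum coefficient -/

theorem algebraMapInv_blockValue {ι : Type*} [LinearOrder ι] (k : ι → ℕ+) (σ : ι → Set ℕ+)
    (s B : Finset ι) {G : Type*} [NormedAddCommGroup G] [InnerProductSpace ℂ G]
    (e : HilbertBasis ℕ+ ℂ G) (t : ℝ) [Decidable (IsClosedBlock k σ s B)] :
    SymmetricAlgebra.algebraMapInv (blockValue k σ s B e t) =
      if IsClosedBlock k σ s B then (t : ℂ) else 0 := by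
  rw [blockValue, map_add, apply_ite SymmetricAlgebra.algebraMapInv,
    apply_ite SymmetricAlgebra.algebraMapInv, map_zero, chiFock, SymmetricAlgebra.algebraMapInv_ι,
    ite_self, add_zero, AlgHom.commutes]
  simp

/-- (A1) and (A2) constrain each block separately, so the sum over adapted partitions can be
detected factor by factor. -/
theorem isAdapted_iff_forall_isClosedBlock {n : ℕ} (k : Fin n → ℕ+) (σ : Fin n → Set ℕ+)
    (R : Finpartition (Finset.univ : Finset (Fin n))) :
    IsAdapted k σ R ↔ ∀ B ∈ R.parts, IsClosedBlock k σ Finset.univ B := by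
  simp only [IsAdapted, IsClosedBlock, Finset.mem_univ, true_implies, ← forall_and]

theorem vacuumExpectation_eq_algebraMapInv {E : Type*} [NormedAddCommGroup E]
    [InnerProductSpace ℂ E] (T : Module.End ℂ (FinFock E)) :
    vacuumExpectation T = SymmetricAlgebra.algebraMapInv (T 1) := by
  rw [vacuumExpectation, UniformSpace.Completion.inner_coe, inner_eq_fockInner, vacuum,
    fockInner_one_left]

end FilteredFock

open FilteredFock in
theorem theorem8p3 {G : Type*} [NormedAddCommGroup G] [InnerProductSpace ℂ G] [CompleteSpace G]
    (e : HilbertBasis ℕ+ ℂ G) (t : ℝ) (ht : 0 ≤ t) (n : ℕ) (k : Fin n → ℕ+)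
    (σ : Fin n → Set ℕ+) :
    FilteredFock.vacuumExpectation
        (List.ofFn fun i => FilteredFock.filteredPoisson e t (k i) (σ i)).prod =
      ∑ R ∈ FilteredFock.adaptedPartitions k σ, (t : ℂ) ^ R.parts.card := by
  classical
  have h := prod_filteredPoisson_one (k := k) (σ := σ) e t ht (List.finRange n)
    (List.sortedLT_finRange n)
  rw [List.toFinset_finRange] at h
  rw [vacuumExpectation_eq_algebraMapInv, List.ofFn_eq_map, h, map_sum, adaptedPartitions,
    Finset.sum_filter]
  refine Finset.sum_congr rfl fun R _ => ?_
  -- The vacuum coefficient is multiplicative, so a single block that is not closed annihilates the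
  -- whole term.
  rw [map_prod, Finset.prod_congr rfl fun B _ => algebraMapInv_blockValue k σ _ B e t,
    Finset.prod_ite_zero, Finset.prod_const]
  by_cases hR : IsAdapted k σ R
  · rw [if_pos hR, if_pos ((isAdapted_iff_forall_isClosedBlock k σ R).1 hR)]
  · rw [if_neg hR, if_neg (mt (isAdapted_iff_forall_isClosedBlock k σ R).2 hR)]
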